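/- All graphs are finite and simple. Let $G=(V,E)$ be a graph. Fix any orientation of the edges of $G$. Let $A_G$ be the real matrix with rows indexed by $E$ and columns indexed by $V\cup E$ in which, for an edge $e$ oriented from $u$ to $v$, the entry $A_G[e,y]$ is $1$ if $y=v$ or $y\neq e$ is an edge incident to $v$, is $-1$ if $y=u$ or $y\neq e$ is an edge incident to $u$, and is $0$ otherwise. Let $B_G$ be the submatrix of $A_G$ formed by the columns indexed by $E$. The permanent index $\mathrm{pind}(M)$ of a real matrix $M$ is the least integer $k\ge 0$ for which there is a square matrix $M'$ with nonzero permanent such that each column of $M'$ is a column of $M$ and each column of $M$ (columns being distinguished by their indices) is used at most $k$ times in $M'$; it is $\infty$ if no such $k$ exists. The graph $G$ is $(k,k')$-choosable if, whenever each vertex $v$ is given a set $L(v)$ of $k$ real numbers and each edge $e$ a set $L(e)$ of $k'$ real numbers, there is a map $f:V\cup E\to\mathbb{R}$ with $f(z)\in L(z)$ for all $z\in V\cup E$ such that $f(x)+\sum_{e\ni x}f(e)\neq f(y)+\sum_{e\ni y}f(e)$ for all adjacent vertices $x,y$. A unicyclic graph is a connected graph that contains exactly one cycle. **Theorem.** For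 every unicyclic graph $U$ and every orientation of its edges, $\mathrm{pind}(B_U)\le 2$, and $U$ is $(1,3)$-choosable. Hence every connected graph with $n$ vertices and $m=n$ edges is $(1,3)$-choosable. -/

import Mathlib

namespace TotalWeighting

/-- `HasPermWitness A k`: there is a square matrix with nonzero permanent, each column of which is
a column of `A` (its `i`-th column is the `c i`-th column of `A`), and in which each column of `A`
is used at most `k` times. -/
def HasPermWitness {R C : Type*} [Fintype R] [DecidableEq R] [DecidableEq C]
    (A : Matrix R C ℝ) (k : ℕ) : Prop :=
  ∃ c : R → C, (A.submatrix id c).permanent ≠ 0 ∧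
    ∀ j : C, (Finset.univ.filter fun i => c i = j).card ≤ k

/-- The permanent index of `A`: the least `k` as above (and `⊤` if there is none). -/
noncomputable def pind {R C : Type*} [Fintype R] [DecidableEq R] [DecidableEq C]
    (A : Matrix R C ℝ) : ℕ∞ :=
  ⨅ (k : ℕ) (_ : HasPermWitness A k), (k : ℕ∞)

/-- An orientation of the edges of `G`: the edge `e` is oriented from `tail e` to `head e`. -/
structure EdgeOrientation {V : Type*} (G : SimpleGraph V) where
  tail : G.edgeSet → V
  head : G.edgeSet → V
  mk_eq : ∀ e, s(tail e, head e) = (e : Sym2 V)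

section Matrices

variable {V : Type*} [DecidableEq V] {G : SimpleGraph V}

/-- The matrix `A_G`: rows are indexed by edges, columns by vertices and edges. -/
def matrixA (D : EdgeOrientation G) : Matrix G.edgeSet (V ⊕ G.edgeSet) ℝ
  | e, .inl y => if y = D.head e then 1 else if y = D.tail e then -1 else 0
  | e, .inr y =>
    if y ≠ e ∧ D.head e ∈ (y : Sym2 V) then 1
    else if y ≠ e ∧ D.tail e ∈ (y : Sym2 V) then -1
    else 0

/-- The matrix `B_G`: the columns of `A_G` that are indexed by edges. -/
def matrixB (D : EdgeOrientation G) : Matrix G.edgeSet G.edgeSet ℝ :=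
  (matrixA D).submatrix id Sum.inr

end Matrices

section Choosability

variable {V : Type*} [DecidableEq V] (G : SimpleGraph V) [Fintype G.edgeSet]

/-- The weight `s(v)` of a vertex under a total weighting `f`. -/
def vertexWeight (f : V ⊕ G.edgeSet → ℝ) (v : V) : ℝ :=
  f (.inl v) + ∑ e ∈ Finset.univ.filter (fun e : G.edgeSet => v ∈ (e : Sym2 V)), f (.inr e)

/-- A total weighting is proper if adjacent vertices have distinct weights. -/
def IsProperTotalWeighting (f : V ⊕ G.edgeSet → ℝ) : Prop :=
  ∀ u v : V, G.Adj u v → vertexWeight G f u ≠ vertexWeight G f v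

/-- Total weight `ψ`-choosability: every assignment of lists `L z` of `ψ z` real numbers admits a
proper total weighting with values in the lists. -/
def IsTotalWeightChoosable (ψ : V ⊕ G.edgeSet → ℕ) : Prop :=
  ∀ L : V ⊕ G.edgeSet → Finset ℝ, (∀ z, (L z).card = ψ z) →
    ∃ f : V ⊕ G.edgeSet → ℝ, IsProperTotalWeighting G f ∧ ∀ z, f z ∈ L z

/-- `(k, k')`-choosability: vertices get lists of size `k`, edges get lists of size `k'`. -/
def IsChoosable (k k' : ℕ) : Prop :=
  IsTotalWeightChoosable G (Sum.elim (fun _ => k) (fun _ => k'))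

end Choosability

/-- The subgraph `C` of `G` is a cycle: it is traced out by a closed walk that is a cycle. -/
def IsCycleSubgraph {V : Type*} {G : SimpleGraph V} (C : G.Subgraph) : Prop :=
  ∃ (u : V) (p : G.Walk u u), p.IsCycle ∧ p.toSubgraph = C

/-- A unicyclic graph: a connected graph that contains exactly one cycle. -/
def IsUnicyclic {V : Type*} (G : SimpleGraph V) : Prop :=
  G.Connected ∧ ∃! C : G.Subgraph, IsCycleSubgraph C

end TotalWeighting

/-! Give each edge a variable and read each row of `matrixB D` as a linear form. Everything reduces
to one claim: the product of these forms has a monomial with all exponents at most 2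
(`HasSmallMonomial`). The permanent of a matrix with repeated columns is a positive multiple of such
a coefficient (`permanent_submatrix_eq`), which bounds `pind`; the Combinatorial Nullstellensatz
turns the same coefficient into a choice from lists of size 3 (`exists_forall_affine_ne_zero`).

The claim is `hasSmallMonomial_edgePoly`, an induction over sparse edge sets without isolated edges.
If all degrees are at most 2, each variable lies in at most two forms and any monomial works.
Otherwise double counting gives a vertex `v` with a pendant edge and at most two non-pendant ones.
Weights on the variables, heaviest on the pendant edges at `v`, single out a top part of the
product. Taking top parts is multiplicative and creates no new monomials, and here it separates the
variables at `v` from those of the smaller edge set, so small monomials of the factors multiply.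

Connected graphs with `m = n` are sparse: the vertices outside a given nonempty set pay for distinct
edges not inside it. Unicyclic graphs have `m = n` because deleting a cycle edge leaves a spanning
tree. -/

namespace TotalWeighting

open MvPolynomial

/-! ### Top-weight parts of polynomials -/

section TopForm

variable {σ R : Type*} [CommRing R]

/-- Substitute `X i ↦ X i * T ^ w i`, where `T` is a new variable. -/
noncomputable def weightHom (w : σ → ℕ) :
    MvPolynomial σ R →+* Polynomial (MvPolynomial σ R) :=
  eval₂Hom (Polynomial.C.comp C) fun i => Polynomial.C (X i) * Polynomial.X ^ w i

/-- The part of `p` of largest weight, for the weights `w` of the variables. -/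
noncomputable def topForm (w : σ → ℕ) (p : MvPolynomial σ R) : MvPolynomial σ R :=
  (weightHom w p).leadingCoeff

theorem weightHom_C_mul_X (w : σ → ℕ) (c : R) (i : σ) :
    weightHom w (C c * X i) = Polynomial.C (C c * X i) * Polynomial.X ^ w i := by
  simp [weightHom, mul_assoc]

theorem weightHom_monomial (w : σ → ℕ) (s : σ →₀ ℕ) (c : R) :
    weightHom w (monomial s c) =
      Polynomial.C (monomial s c) * Polynomial.X ^ (s.sum fun i k => w i * k) := by
  simp only [weightHom, coe_eval₂Hom, eval₂_monomial, RingHom.comp_apply, mul_pow, ← pow_mul,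
    Finsupp.prod, Finset.prod_mul_distrib, Finsupp.sum, Finset.prod_pow_eq_pow_sum]
  rw [← mul_assoc, monomial_eq, map_mul, Finsupp.prod, map_prod]
  simp

theorem coeff_coeff_weightHom (w : σ → ℕ) (p : MvPolynomial σ R) (m : σ →₀ ℕ) (k : ℕ) :
    coeff m ((weightHom w p).coeff k) =
      if (m.sum fun i n => w i * n) = k then coeff m p else 0 := by
  classical
  induction p using MvPolynomial.induction_on' with
  | monomial s c =>
    rw [weightHom_monomial, Polynomial.coeff_C_mul, Polynomial.coeff_X_pow]
    by_cases h : s = m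
    · subst h
      by_cases h' : k = s.sum fun i n => w i * n
      · simp [h']
      · simp [h', Ne.symm h']
    · split_ifs <;> simp [coeff_monomial, h]
  | add p q hp hq =>
    simp only [map_add, Polynomial.coeff_add, coeff_add, hp, hq]
    split_ifs <;> simp

theorem coeff_ne_zero_of_coeff_topForm_ne_zero {w : σ → ℕ} {p : MvPolynomial σ R} {m : σ →₀ ℕ}
    (h : coeff m (topForm w p) ≠ 0) : coeff m p ≠ 0 := by
  rw [topForm, Polynomial.leadingCoeff, coeff_coeff_weightHom] at h
  split_ifs at h
  · exact h
  · exact absurd rfl h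

theorem topForm_ne_zero (w : σ → ℕ) {p : MvPolynomial σ R} (hp : p ≠ 0) : topForm w p ≠ 0 := by
  intro h
  apply hp
  ext m
  have := coeff_coeff_weightHom w p m (m.sum fun i n => w i * n)
  rw [Polynomial.leadingCoeff_eq_zero.1 h] at this
  simpa using this.symm

/-- Leading coefficients multiply over a domain; this is why the top part is defined through an
auxiliary variable. -/
theorem topForm_prod [IsDomain R] {ι : Type*} (w : σ → ℕ) (s : Finset ι)
    (p : ι → MvPolynomial σ R) : topForm w (∏ i ∈ s, p i) = ∏ i ∈ s, topForm w (p i) := by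
  simp only [topForm, map_prod, Polynomial.leadingCoeff_prod]

theorem topForm_mul [IsDomain R] (w : σ → ℕ) (p q : MvPolynomial σ R) :
    topForm w (p * q) = topForm w p * topForm w q := by
  simp only [topForm, map_mul, Polynomial.leadingCoeff_mul]

/-- The linear form with variables in `s` and coefficients `c`. -/
noncomputable def linForm (c : σ → R) (s : Finset σ) : MvPolynomial σ R :=
  ∑ i ∈ s, C (c i) * X i

theorem coeff_single_linForm [DecidableEq σ] (c : σ → R) (s : Finset σ) (i : σ) :
    coeff (Finsupp.single i 1) (linForm c s) = if i ∈ s then c i else 0 := by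
  classical
  simp only [linForm, coeff_sum, coeff_C_mul, coeff_X]
  simp [Finsupp.single_left_inj]

theorem linForm_ne_zero {c : σ → R} {s : Finset σ} {i : σ} (hi : i ∈ s) (hc : c i ≠ 0) :
    linForm c s ≠ 0 := by
  classical
  intro h
  have := coeff_single_linForm c s i
  rw [h, if_pos hi] at this
  exact hc (by simpa using this.symm)

theorem degreeOf_linForm_le (c : σ → R) (s : Finset σ) (i : σ) :
    degreeOf i (linForm c s) ≤ 1 := by
  classical
  refine (degreeOf_sum_le i s _).trans (Finset.sup_le fun j _ => ?_)
  refine (degreeOf_C_mul_le _ _ _).trans (degreeOf_le_iff.2 fun m hm => ?_)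
  have hm' : m = Finsupp.single j 1 := by
    by_contra hne
    rw [mem_support_iff, coeff_X, if_neg (Ne.symm hne)] at hm
    exact hm rfl
  rw [hm', Finsupp.single_apply]
  split_ifs <;> norm_num

theorem degreeOf_linForm_eq_zero {c : σ → R} {s : Finset σ} {i : σ} (h : i ∈ s → c i = 0) :
    degreeOf i (linForm c s) = 0 := by
  classical
  rw [← Nat.le_zero]
  refine (degreeOf_sum_le i s _).trans (Finset.sup_le fun j hj => ?_)
  by_cases hij : i = j
  · subst hij
    simp [h hj]
  · refine (degreeOf_C_mul_le _ _ _).trans (degreeOf_le_iff.2 fun m hm => ?_)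
    have hm' : m = Finsupp.single j 1 := by
      by_contra hne
      rw [mem_support_iff, coeff_X, if_neg (Ne.symm hne)] at hm
      exact hm rfl
    rw [hm', Finsupp.single_eq_of_ne hij]

/-- In a product of linear forms, the degree in a variable is at most the number of factors that
contain it. -/
theorem degreeOf_prod_linForm_le {ι : Type*} (r : Finset ι) (c : ι → σ → R) (s : ι → Finset σ)
    (i : σ) {u : Finset ι} (hu : ∀ k ∈ r, i ∈ s k → c k i ≠ 0 → k ∈ u) :
    degreeOf i (∏ k ∈ r, linForm (c k) (s k)) ≤ u.card := by
  classical
  calc degreeOf i (∏ k ∈ r, linForm (c k) (s k))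
      ≤ ∑ k ∈ r, degreeOf i (linForm (c k) (s k)) := degreeOf_prod_le _ _ _
    _ ≤ ∑ k ∈ r, if k ∈ u then 1 else 0 := by
        refine Finset.sum_le_sum fun k hk => ?_
        split_ifs with h
        · exact degreeOf_linForm_le _ _ _
        · exact (degreeOf_linForm_eq_zero fun hi => by_contra fun hc => h (hu k hk hi hc)).le
    _ = (r.filter (· ∈ u)).card := by rw [Finset.card_filter]
    _ ≤ u.card := Finset.card_le_card fun k hk => (Finset.mem_filter.1 hk).2

theorem linForm_congr {c c' : σ → R} {s s' : Finset σ} (hs : s' ⊆ s)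
    (h : ∀ i ∈ s', c i = c' i) (h0 : ∀ i ∈ s, i ∉ s' → c i = 0) :
    linForm c s = linForm c' s' := by
  rw [linForm, linForm, ← Finset.sum_subset hs]
  · exact Finset.sum_congr rfl fun i hi => by rw [h i hi]
  · intro i hi hi'
    simp [h0 i hi hi']

theorem linForm_const_mul (a : R) (s : Finset σ) :
    linForm (fun _ => a) s = C a * ∑ i ∈ s, X i := by
  rw [linForm, Finset.mul_sum]

/-- The heaviest part of a linear form. -/
theorem topForm_linForm {w : σ → ℕ} {c : σ → R} {s : Finset σ} {d : ℕ}
    (hle : ∀ i ∈ s, c i ≠ 0 → w i ≤ d) (hex : ∃ i ∈ s, c i ≠ 0 ∧ w i = d) :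
    topForm w (linForm c s) = linForm c (s.filter fun i => w i = d) := by
  have hw : weightHom w (linForm c s) =
      ∑ i ∈ s, Polynomial.C (C (c i) * X i) * Polynomial.X ^ w i := by
    simp only [linForm, map_sum, weightHom_C_mul_X]
  have hc : (weightHom w (linForm c s)).coeff d = linForm c (s.filter fun i => w i = d) := by
    rw [hw, Polynomial.finsetSum_coeff, linForm, Finset.sum_filter]
    refine Finset.sum_congr rfl fun i _ => ?_
    rw [Polynomial.coeff_C_mul, Polynomial.coeff_X_pow]
    by_cases h : w i = d
    · simp [h]
    · simp [h, Ne.symm h]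
  obtain ⟨i, hi, hci, hwi⟩ := hex
  have hdeg : (weightHom w (linForm c s)).natDegree = d := by
    refine Polynomial.natDegree_eq_of_le_of_coeff_ne_zero ?_ ?_
    · rw [hw]
      refine Polynomial.natDegree_sum_le_of_forall_le _ _ fun j hj => ?_
      by_cases hcj : c j = 0
      · simp [hcj]
      · exact (Polynomial.natDegree_C_mul_X_pow_le _ _).trans (hle j hj hcj)
    · rw [hc]
      exact linForm_ne_zero (Finset.mem_filter.2 ⟨hi, hwi⟩) hci
  rw [topForm, Polynomial.leadingCoeff, hdeg, hc]

end TopForm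

/-! ### Monomials with exponents at most two -/

section Small

variable {σ R : Type*} [CommRing R]

/-- Some monomial of `p` has all its exponents at most `2`. -/
def HasSmallMonomial (p : MvPolynomial σ R) : Prop :=
  ∃ m : σ →₀ ℕ, (∀ i, m i ≤ 2) ∧ coeff m p ≠ 0

theorem HasSmallMonomial.of_topForm {w : σ → ℕ} {p : MvPolynomial σ R}
    (h : HasSmallMonomial (topForm w p)) : HasSmallMonomial p :=
  let ⟨m, hm, hc⟩ := h
  ⟨m, hm, coeff_ne_zero_of_coeff_topForm_ne_zero hc⟩

theorem hasSmallMonomial_of_degreeOf_le {p : MvPolynomial σ R} (hp : p ≠ 0)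
    (hd : ∀ i, degreeOf i p ≤ 2) : HasSmallMonomial p := by
  obtain ⟨m, hm⟩ := ne_zero_iff.1 hp
  exact ⟨m, fun i => degreeOf_le_iff.1 (hd i) m (mem_support_iff.2 hm), hm⟩

theorem degreeOf_topForm_le (w : σ → ℕ) (p : MvPolynomial σ R) (i : σ) :
    degreeOf i (topForm w p) ≤ degreeOf i p :=
  degreeOf_le_iff.2 fun m hm => degreeOf_le_iff.1 le_rfl m
    (mem_support_iff.2 (coeff_ne_zero_of_coeff_topForm_ne_zero (mem_support_iff.1 hm)))

/-- Polynomials in disjoint sets of variables: monomials multiply without interference. -/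
theorem HasSmallMonomial.mul [IsDomain R] {p q : MvPolynomial σ R} (hp : HasSmallMonomial p)
    (hq : HasSmallMonomial q) (hpq : ∀ i, degreeOf i p = 0 ∨ degreeOf i q = 0) :
    HasSmallMonomial (p * q) := by
  classical
  obtain ⟨m, hm, hmc⟩ := hp
  obtain ⟨n, hn, hnc⟩ := hq
  have key : ∀ (r : MvPolynomial σ R) (a : σ →₀ ℕ) (i : σ), coeff a r ≠ 0 → degreeOf i r = 0 →
      a i = 0 := fun r a i ha hi =>
    Nat.le_zero.1 (degreeOf_le_iff.1 hi.le a (mem_support_iff.2 ha))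
  refine ⟨m + n, fun i => ?_, ?_⟩
  · rcases hpq i with h | h
    · simpa [key p m i hmc h] using hn i
    · simpa [key q n i hnc h] using hm i
  · rw [coeff_mul, Finset.sum_eq_single (m, n)]
    · exact mul_ne_zero hmc hnc
    · rintro ⟨a, b⟩ hab hne
      by_contra h0
      have ha := left_ne_zero_of_mul h0
      have hb := right_ne_zero_of_mul h0
      rw [Finset.HasAntidiagonal.mem_antidiagonal] at hab
      have hpt : ∀ i, a i = m i ∧ b i = n i := by
        intro i
        have hi : a i + b i = m i + n i := by simpa using DFunLike.congr_fun hab i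
        rcases hpq i with h | h
        · have h1 := key p a i ha h
          have h2 := key p m i hmc h
          omega
        · have h1 := key q b i hb h
          have h2 := key q n i hnc h
          omega
      exact hne (Prod.ext (Finsupp.ext fun i => (hpt i).1) (Finsupp.ext fun i => (hpt i).2))
    · intro h
      exact absurd ((Finset.HasAntidiagonal.mem_antidiagonal (a := (m, n))).2 rfl) h

/-- A product of sums of variables contains every monomial obtained by choosing a variable from
each factor. -/
theorem coeff_prod_sum_X_pos {ι : Type*} (s : Finset ι) (T : ι → Finset σ)
    (c : ι → σ) (hc : ∀ i ∈ s, c i ∈ T i) :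
    0 < coeff (∑ i ∈ s, Finsupp.single (c i) 1)
      (∏ i ∈ s, ∑ j ∈ T i, (X j : MvPolynomial σ ℝ)) ∧
    ∀ m, 0 ≤ coeff m (∏ i ∈ s, ∑ j ∈ T i, (X j : MvPolynomial σ ℝ)) := by
  classical
  induction s using Finset.induction_on with
  | empty =>
    refine ⟨by simp, fun m => ?_⟩
    rw [Finset.prod_empty, coeff_one]
    split_ifs <;> norm_num
  | insert a s ha ih =>
    obtain ⟨ih1, ih2⟩ := ih fun i hi => hc i (Finset.mem_insert_of_mem hi)
    have hnn : ∀ m, 0 ≤ coeff m (∑ j ∈ T a, (X j : MvPolynomial σ ℝ)) := by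
      intro m
      rw [coeff_sum]
      refine Finset.sum_nonneg fun j _ => ?_
      rw [coeff_X]
      split_ifs <;> norm_num
    have hpos : 0 < coeff (Finsupp.single (c a) 1) (∑ j ∈ T a, (X j : MvPolynomial σ ℝ)) := by
      rw [coeff_sum]
      refine Finset.sum_pos' (fun j _ => ?_) ⟨c a, hc a (Finset.mem_insert_self _ _), by simp⟩
      rw [coeff_X]
      split_ifs <;> norm_num
    rw [Finset.prod_insert ha, Finset.sum_insert ha]
    constructor
    · rw [coeff_mul]
      exact Finset.sum_pos' (fun x _ => mul_nonneg (hnn _) (ih2 _))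
        ⟨(Finsupp.single (c a) 1, ∑ i ∈ s, Finsupp.single (c i) 1),
          (Finset.HasAntidiagonal.mem_antidiagonal).2 rfl, mul_pos hpos ih1⟩
    · intro m
      rw [coeff_mul]
      exact Finset.sum_nonneg fun x _ => mul_nonneg (hnn _) (ih2 _)

/-- A product of nonzero multiples of sums of variables has a small monomial if we can choose
a variable from each factor, no variable more than twice. -/
theorem hasSmallMonomial_prod_sum_X {ι : Type*} (s : Finset ι) (ε : ι → ℝ)
    (hε : ∀ i ∈ s, ε i ≠ 0) (T : ι → Finset σ) (c : ι → σ) (hc : ∀ i ∈ s, c i ∈ T i)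
    (h2 : ∀ j, (∑ i ∈ s, Finsupp.single (c i) 1 : σ →₀ ℕ) j ≤ 2) :
    HasSmallMonomial (∏ i ∈ s, linForm (fun _ => ε i) (T i)) := by
  refine ⟨_, h2, ?_⟩
  simp only [linForm_const_mul, Finset.prod_mul_distrib, ← map_prod, coeff_C_mul]
  exact mul_ne_zero (Finset.prod_ne_zero_iff.2 hε) (coeff_prod_sum_X_pos s T c hc).1.ne'

end Small

/-! ### Signed incidences of edges -/

section EdgeSets

variable {V : Type*} {t h : Sym2 V → V}

theorem eq_of_mem_of_mem {e f : Sym2 V} {x y : V} (hxy : x ≠ y) (hxe : x ∈ e) (hye : y ∈ e)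
    (hxf : x ∈ f) (hyf : y ∈ f) : e = f :=
  ((Sym2.mem_and_mem_iff hxy).1 ⟨hxe, hye⟩).trans ((Sym2.mem_and_mem_iff hxy).1 ⟨hxf, hyf⟩).symm

theorem mem_iff_of_orientation (hth : ∀ e, s(t e, h e) = e) (e : Sym2 V) (v : V) :
    v ∈ e ↔ v = t e ∨ v = h e := by
  conv_lhs => rw [← hth e]
  exact Sym2.mem_iff

theorem tail_ne_head (hth : ∀ e, s(t e, h e) = e) {e : Sym2 V} (he : ¬ e.IsDiag) : t e ≠ h e := by
  rw [← hth e, Sym2.mk_isDiag_iff] at he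
  exact he

variable [DecidableEq V]

/-- The entry of the edge-edge matrix, for `e` oriented from `t e` to `h e`. -/
def inc (t h : Sym2 V → V) (e f : Sym2 V) : ℝ :=
  (if h e ∈ f then 1 else 0) - (if t e ∈ f then 1 else 0)

/-- The sign with which the weight of `v` occurs in the row of the edge `e`. -/
def endSign (t h : Sym2 V → V) (v : V) (e : Sym2 V) : ℝ :=
  (if h e = v then 1 else 0) - (if t e = v then 1 else 0)

theorem inc_eq_zero_of_forall_notMem (hth : ∀ e, s(t e, h e) = e) {e f : Sym2 V}
    (hef : ∀ x ∈ e, x ∉ f) : inc t h e f = 0 := by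
  have h1 := hef _ ((mem_iff_of_orientation hth e (t e)).2 (Or.inl rfl))
  have h2 := hef _ ((mem_iff_of_orientation hth e (h e)).2 (Or.inr rfl))
  simp [inc, h1, h2]

theorem inc_self (hth : ∀ e, s(t e, h e) = e) (e : Sym2 V) : inc t h e e = 0 := by
  have h1 := (mem_iff_of_orientation hth e (t e)).2 (Or.inl rfl)
  have h2 := (mem_iff_of_orientation hth e (h e)).2 (Or.inr rfl)
  simp [inc, h1, h2]

/-- Distinct edges share at most one vertex, so the entry depends only on the row and the shared
vertex. Hence a row restricted to other edges at `v` is a constant times a sum of variables, which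
rules out cancellation later. -/
theorem inc_eq_endSign (hth : ∀ e, s(t e, h e) = e) {e f : Sym2 V} (he : ¬ e.IsDiag)
    (hef : e ≠ f) {v : V} (hve : v ∈ e) (hvf : v ∈ f) : inc t h e f = endSign t h v e := by
  have hne := tail_ne_head hth he
  have h1 := (mem_iff_of_orientation hth e (t e)).2 (Or.inl rfl)
  have h2 := (mem_iff_of_orientation hth e (h e)).2 (Or.inr rfl)
  rcases (mem_iff_of_orientation hth e v).1 hve with rfl | rfl
  · have : h e ∉ f := fun h' => hef (eq_of_mem_of_mem hne h1 h2 hvf h')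
    simp [inc, endSign, this, hvf, hne.symm]
  · have : t e ∉ f := fun h' => hef (eq_of_mem_of_mem hne h1 h2 h' hvf)
    simp [inc, endSign, this, hvf, hne]

theorem endSign_ne_zero (hth : ∀ e, s(t e, h e) = e) {e : Sym2 V} (he : ¬ e.IsDiag) {v : V}
    (hve : v ∈ e) : endSign t h v e ≠ 0 := by
  have hne := tail_ne_head hth he
  rcases (mem_iff_of_orientation hth e v).1 hve with rfl | rfl
  · simp [endSign, hne.symm]
  · simp [endSign, hne]

theorem inc_ne_zero_iff (hth : ∀ e, s(t e, h e) = e) {e f : Sym2 V} (he : ¬ e.IsDiag) :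
    inc t h e f ≠ 0 ↔ e ≠ f ∧ ∃ v, v ∈ e ∧ v ∈ f := by
  constructor
  · intro h0
    refine ⟨?_, ?_⟩
    · rintro rfl
      exact h0 (inc_self hth e)
    · by_contra! hc
      exact h0 (inc_eq_zero_of_forall_notMem hth hc)
  · rintro ⟨hef, v, hve, hvf⟩
    rw [inc_eq_endSign hth he hef hve hvf]
    exact endSign_ne_zero hth he hve

/-- The product of the linear forms given by the rows of the edge-edge matrix. -/
noncomputable def edgePoly (t h : Sym2 V → V) (E : Finset (Sym2 V)) : MvPolynomial (Sym2 V) ℝ :=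
  ∏ e ∈ E, linForm (inc t h e) E

/-- The number of edges at `v`. -/
def edgeDeg (E : Finset (Sym2 V)) (v : V) : ℕ := (E.filter (v ∈ ·)).card

/-- No set of vertices contains more edges than vertices. -/
def IsSparse (E : Finset (Sym2 V)) : Prop :=
  ∀ S : Finset V, ∀ E' ⊆ E, (∀ e ∈ E', ∀ v ∈ e, v ∈ S) → E'.card ≤ S.card

/-- Every edge meets another one. -/
def NoIsolatedEdge (E : Finset (Sym2 V)) : Prop :=
  ∀ e ∈ E, ∃ f ∈ E, e ≠ f ∧ ∃ v, v ∈ e ∧ v ∈ f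

theorem eq_of_edgeDeg_eq_one {E : Finset (Sym2 V)} {v : V} (hv : edgeDeg E v = 1) {e f : Sym2 V}
    (he : e ∈ E) (hf : f ∈ E) (hve : v ∈ e) (hvf : v ∈ f) : e = f :=
  Finset.card_le_one.1 hv.le e (Finset.mem_filter.2 ⟨he, hve⟩) f (Finset.mem_filter.2 ⟨hf, hvf⟩)

theorem edgeDeg_pos {E : Finset (Sym2 V)} {v : V} {e : Sym2 V} (he : e ∈ E) (hve : v ∈ e) :
    1 ≤ edgeDeg E v :=
  Finset.card_pos.2 ⟨e, Finset.mem_filter.2 ⟨he, hve⟩⟩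

theorem linForm_inc_ne_zero (hth : ∀ e, s(t e, h e) = e) {E : Finset (Sym2 V)}
    (hd : ∀ e ∈ E, ¬ e.IsDiag) (hiso : NoIsolatedEdge E) {e : Sym2 V} (he : e ∈ E) :
    linForm (inc t h e) E ≠ 0 := by
  obtain ⟨f, hf, hef⟩ := hiso e he
  exact linForm_ne_zero hf ((inc_ne_zero_iff hth (hd e he)).2 hef)

/-- An edge `f` meets at most one other edge at each end, so its variable occurs in at most two
rows. The product is nonzero because no edge is isolated. -/
theorem hasSmallMonomial_edgePoly_of_edgeDeg_le_two (hth : ∀ e, s(t e, h e) = e)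
    {E : Finset (Sym2 V)} (hd : ∀ e ∈ E, ¬ e.IsDiag) (hiso : NoIsolatedEdge E)
    (hdeg : ∀ v, edgeDeg E v ≤ 2) : HasSmallMonomial (edgePoly t h E) := by
  refine hasSmallMonomial_of_degreeOf_le
    (Finset.prod_ne_zero_iff.2 fun e he => linForm_inc_ne_zero hth hd hiso he) fun f => ?_
  by_cases hf : f ∈ E
  · have hcard : ∀ v ∈ f, ((E.filter (v ∈ ·)).erase f).card ≤ 1 := by
      intro v hv
      rw [Finset.card_erase_of_mem (Finset.mem_filter.2 ⟨hf, hv⟩)]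
      have := hdeg v
      rw [edgeDeg] at this
      omega
    have hsub := degreeOf_prod_linForm_le E (inc t h) (fun _ => E) f
      (u := (E.filter (t f ∈ ·)).erase f ∪ (E.filter (h f ∈ ·)).erase f) (by
        intro e he _ hne
        obtain ⟨hef, v, hve, hvf⟩ := (inc_ne_zero_iff hth (hd e he)).1 hne
        rcases (mem_iff_of_orientation hth f v).1 hvf with rfl | rfl
        · exact Finset.mem_union_left _
            (Finset.mem_erase.2 ⟨hef, Finset.mem_filter.2 ⟨he, hve⟩⟩)
        · exact Finset.mem_union_right _
            (Finset.mem_erase.2 ⟨hef, Finset.mem_filter.2 ⟨he, hve⟩⟩))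
    have h1 := hcard _ ((mem_iff_of_orientation hth f _).2 (Or.inl rfl))
    have h2 := hcard _ ((mem_iff_of_orientation hth f _).2 (Or.inr rfl))
    exact hsub.trans ((Finset.card_union_le _ _).trans (by omega))
  · have hsub := degreeOf_prod_linForm_le E (inc t h) (fun _ => E) f (u := ∅)
      (fun e _ hf' => absurd hf' hf)
    exact hsub.trans (by simp)

/-! ### Stripping a star from a sparse edge set -/

/-- In a sparse edge set, either all degrees are at most two, or some vertex
with a pendant edge has at most two other edges that are not pendant. -/
theorem edgeDeg_le_two_or_exists_pendant [Fintype V] {E : Finset (Sym2 V)}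
    (hd : ∀ e ∈ E, ¬ e.IsDiag) (hsp : IsSparse E) :
    (∀ v, edgeDeg E v ≤ 2) ∨
      ∃ v, 2 ≤ edgeDeg E v ∧ (∃ e ∈ E, v ∈ e ∧ ∃ w ∈ e, edgeDeg E w = 1) ∧
        (E.filter fun e => v ∈ e ∧ ∀ w ∈ e, edgeDeg E w ≠ 1).card ≤ 2 := by
  classical
  by_contra! hcon
  obtain ⟨⟨v₀, hv₀⟩, hcon⟩ := hcon
  set H : Finset V := Finset.univ.filter fun v => 2 ≤ edgeDeg E v with hH
  set EH : Finset (Sym2 V) := E.filter fun e => ∀ w ∈ e, edgeDeg E w ≠ 1 with hEH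
  have hEHmem : ∀ e ∈ EH, ∀ w ∈ e, w ∈ H := by
    intro e he w hw
    rw [hEH, Finset.mem_filter] at he
    have h1 := edgeDeg_pos he.1 hw
    have h2 := he.2 w hw
    exact Finset.mem_filter.2 ⟨Finset.mem_univ _, by omega⟩
  -- Sparsity bounds the non-pendant edges `EH` by the vertices `H` of degree at least 2. If the
  -- lemma failed, every vertex of `H` would have `EH`-degree at least 2, and `v₀` at least 3,
  -- contradicting the handshake count.
  have hcard : EH.card ≤ H.card := hsp H EH (Finset.filter_subset _ _) hEHmem
  have hr : ∀ v, (EH.filter (v ∈ ·)) = E.filter fun e => v ∈ e ∧ ∀ w ∈ e, edgeDeg E w ≠ 1 := by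
    intro v
    ext e
    simp only [hEH, Finset.mem_filter]
    tauto
  have hpend : ∀ v ∈ H, (∃ e ∈ E, v ∈ e ∧ ∃ w ∈ e, edgeDeg E w = 1) →
      3 ≤ (EH.filter (v ∈ ·)).card := by
    intro v hv he
    rw [hr]
    exact hcon v (Finset.mem_filter.1 hv).2 he
  have hnopend : ∀ v ∈ H, (¬ ∃ e ∈ E, v ∈ e ∧ ∃ w ∈ e, edgeDeg E w = 1) →
      (EH.filter (v ∈ ·)).card = edgeDeg E v := by
    intro v hv he
    push Not at he
    rw [hr, edgeDeg]
    congr 1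
    ext e
    simp only [Finset.mem_filter]
    exact ⟨fun h => ⟨h.1, h.2.1⟩, fun h => ⟨h.1, h.2, he e h.1 h.2⟩⟩
  have hge : ∀ v ∈ H, 2 ≤ (EH.filter (v ∈ ·)).card := by
    intro v hv
    by_cases he : ∃ e ∈ E, v ∈ e ∧ ∃ w ∈ e, edgeDeg E w = 1
    · exact (by norm_num : 2 ≤ 3).trans (hpend v hv he)
    · rw [hnopend v hv he]
      exact (Finset.mem_filter.1 hv).2
  have hsum : ∑ v ∈ H, (EH.filter (v ∈ ·)).card = EH.card * 2 := by
    have := Finset.sum_card_bipartiteAbove_eq_sum_card_bipartiteBelow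
      (fun (v : V) (e : Sym2 V) => v ∈ e) (s := H) (t := EH)
    simp only [Finset.bipartiteAbove, Finset.bipartiteBelow] at this
    rw [this, ← smul_eq_mul, ← Finset.sum_const]
    refine Finset.sum_congr rfl fun e he => ?_
    rw [← Sym2.card_toFinset_of_not_isDiag e (hd e (Finset.mem_filter.1 he).1)]
    congr 1
    ext v
    simp only [Finset.mem_filter, Sym2.mem_toFinset]
    exact ⟨fun h => h.2, fun h => ⟨hEHmem e he v h, h⟩⟩
  have hv₀H : v₀ ∈ H := Finset.mem_filter.2 ⟨Finset.mem_univ _, by omega⟩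
  have hlt : ∑ _v ∈ H, 2 < ∑ v ∈ H, (EH.filter (v ∈ ·)).card := by
    refine Finset.sum_lt_sum hge ⟨v₀, hv₀H, ?_⟩
    by_cases he : ∃ e ∈ E, v₀ ∈ e ∧ ∃ w ∈ e, edgeDeg E w = 1
    · exact hpend v₀ hv₀H he
    · rw [hnopend v₀ hv₀H he]
      exact hv₀
  rw [hsum, Finset.sum_const, smul_eq_mul] at hlt
  omega

/-- The combinatorial choice of monomial at a vertex with at least two pendant edges `A` and at most
two other edges `F`. -/
theorem hasSmallMonomial_star {σ : Type*} [Fintype σ] [DecidableEq σ] {A F : Finset σ}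
    (hAF : Disjoint A F) (hA : 2 ≤ A.card) (hF : F.card ≤ 2) {ε : σ → ℝ}
    (hε : ∀ e ∈ A ∪ F, ε e ≠ 0) :
    HasSmallMonomial ((∏ e ∈ A, linForm (fun _ => ε e) (A.erase e)) *
      ∏ e ∈ F, linForm (fun _ => ε e) A) := by
  classical
  -- The rows of `A` choose along a cyclic permutation, which avoids the missing variable `e`; the
  -- rows of `F` choose injectively. Each variable is thus chosen at most once by each group.
  obtain ⟨p, hp, -⟩ := Finset.exists_cycleOn A
  have hnt : (A : Set σ).Nontrivial := Finset.one_lt_card_iff_nontrivial.1 hA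
  obtain ⟨a, ha⟩ := hnt.nonempty
  have : Nonempty σ := ⟨a⟩
  obtain ⟨g, hgA, hg⟩ := Set.Finite.exists_injOn_of_encard_le (s := (F : Set σ)) (t := (A : Set σ))
    F.finite_toSet (by
      rw [Set.encard_coe_eq_coe_finsetCard, Set.encard_coe_eq_coe_finsetCard]
      exact_mod_cast hF.trans hA)
  have hF' : ∀ e ∈ F, e ∉ A := fun e he heA => Finset.disjoint_left.1 hAF heA he
  have hmain := hasSmallMonomial_prod_sum_X (A ∪ F) ε hε (fun e => if e ∈ A then A.erase e else A)
    (fun e => if e ∈ A then p e else g e) (by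
      intro e he
      by_cases heA : e ∈ A
      · simp only [if_pos heA]
        exact Finset.mem_erase.2 ⟨hp.apply_ne hnt heA, hp.1.mapsTo heA⟩
      · simp only [if_neg heA]
        exact hgA ((Finset.mem_union.1 he).resolve_left heA)) (by
      intro j
      rw [Finsupp.finsetSum_apply]
      simp only [Finsupp.single_apply]
      rw [Finset.sum_union hAF, ← Finset.card_filter, ← Finset.card_filter]
      have h1 : (A.filter fun e => (if e ∈ A then p e else g e) = j).card ≤ 1 := by
        refine Finset.card_le_one.2 fun x hx y hy => ?_
        rw [Finset.mem_filter] at hx hy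
        have hx2 := hx.2
        have hy2 := hy.2
        rw [if_pos hx.1] at hx2
        rw [if_pos hy.1] at hy2
        exact p.injective (hx2.trans hy2.symm)
      have h2 : (F.filter fun e => (if e ∈ A then p e else g e) = j).card ≤ 1 := by
        refine Finset.card_le_one.2 fun x hx y hy => ?_
        rw [Finset.mem_filter] at hx hy
        have hx2 := hx.2
        have hy2 := hy.2
        rw [if_neg (hF' x hx.1)] at hx2
        rw [if_neg (hF' y hy.1)] at hy2
        exact hg hx.1 hy.1 (hx2.trans hy2.symm)
      omega)
  rw [Finset.prod_union hAF] at hmain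
  convert hmain using 2
  · exact Finset.prod_congr rfl fun e he => by rw [if_pos he]
  · exact Finset.prod_congr rfl fun e he => by rw [if_neg (hF' e he)]

/-- In the top part, rows of `F` see only `A`, and rows of `E''` only `E''`. Rows of `I` involve
only `F` from the start. Rows of `A` see only `A` when `A` has two elements; a single pendant row
involves only `F`. The variable groups `A`, `F` and `E''` are disjoint, and `E''` is handled by
induction. -/
theorem hasSmallMonomial_edgePoly [Fintype V] (hth : ∀ e, s(t e, h e) = e) (E : Finset (Sym2 V))
    (hd : ∀ e ∈ E, ¬ e.IsDiag) (hiso : NoIsolatedEdge E) (hsp : IsSparse E) :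
    HasSmallMonomial (edgePoly t h E) := by
  classical
  induction E using Finset.strongInduction with
  | H E ih =>
  rcases edgeDeg_le_two_or_exists_pendant hd hsp with hdeg | ⟨v, hv2, hpend, hFcard⟩
  · exact hasSmallMonomial_edgePoly_of_edgeDeg_le_two hth hd hiso hdeg
  -- The pendant edges at `v`, the other edges at `v`, and the edges isolated by removing `v`.
  set D := E.filter (v ∈ ·) with hD
  set A := D.filter fun e => ∃ w ∈ e, edgeDeg E w = 1 with hA
  set F := D.filter fun e => ¬ ∃ w ∈ e, edgeDeg E w = 1 with hF
  set E' := E.filter (v ∉ ·) with hE'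
  set I := E'.filter fun e => ∀ f ∈ E', e ≠ f → ∀ x ∈ e, x ∉ f with hI
  set E'' := E'.filter fun e => ¬ ∀ f ∈ E', e ≠ f → ∀ x ∈ e, x ∉ f with hE''
  have memD : ∀ {e}, e ∈ D ↔ e ∈ E ∧ v ∈ e := Finset.mem_filter
  have memA : ∀ {e}, e ∈ A ↔ e ∈ D ∧ ∃ w ∈ e, edgeDeg E w = 1 := Finset.mem_filter
  have memF : ∀ {e}, e ∈ F ↔ e ∈ D ∧ ¬ ∃ w ∈ e, edgeDeg E w = 1 := Finset.mem_filter
  have memE' : ∀ {e}, e ∈ E' ↔ e ∈ E ∧ v ∉ e := Finset.mem_filter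
  have memI : ∀ {e}, e ∈ I ↔ e ∈ E' ∧ ∀ f ∈ E', e ≠ f → ∀ x ∈ e, x ∉ f := Finset.mem_filter
  have memE'' : ∀ {e}, e ∈ E'' ↔ e ∈ E' ∧ ¬ ∀ f ∈ E', e ≠ f → ∀ x ∈ e, x ∉ f :=
    Finset.mem_filter
  have hF2 : F.card ≤ 2 := by
    convert hFcard using 2
    ext e
    rw [memF, memD, Finset.mem_filter]
    push Not
    tauto
  have hDcard : A.card + F.card = D.card := Finset.card_filter_add_card_filter_not _
  have hv2' : 2 ≤ D.card := hv2
  have hAne : A.Nonempty := by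
    obtain ⟨e, he, hve, hw⟩ := hpend
    exact ⟨e, memA.2 ⟨memD.2 ⟨he, hve⟩, hw⟩⟩
  have hAF : Disjoint A F := Finset.disjoint_filter_filter_not _ _ _
  have hAE : ∀ e ∈ A, e ∈ E := fun e he => (memD.1 (memA.1 he).1).1
  have hFE : ∀ e ∈ F, e ∈ E := fun e he => (memD.1 (memF.1 he).1).1
  have hIE : ∀ e ∈ I, e ∈ E := fun e he => (memE'.1 (memI.1 he).1).1
  have hE''E : ∀ e ∈ E'', e ∈ E := fun e he => (memE'.1 (memE''.1 he).1).1
  have hAv : ∀ e ∈ A, v ∈ e := fun e he => (memD.1 (memA.1 he).1).2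
  have hFv : ∀ e ∈ F, v ∈ e := fun e he => (memD.1 (memF.1 he).1).2
  have hIv : ∀ e ∈ I, v ∉ e := fun e he => (memE'.1 (memI.1 he).1).2
  have hE''v : ∀ e ∈ E'', v ∉ e := fun e he => (memE'.1 (memE''.1 he).1).2
  have hcases : ∀ e ∈ E, e ∈ A ∨ e ∈ F ∨ e ∈ I ∨ e ∈ E'' := by
    intro e he
    by_cases h1 : v ∈ e
    · by_cases h2 : ∃ w ∈ e, edgeDeg E w = 1
      · exact Or.inl (memA.2 ⟨memD.2 ⟨he, h1⟩, h2⟩)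
      · exact Or.inr (Or.inl (memF.2 ⟨memD.2 ⟨he, h1⟩, h2⟩))
    · by_cases h2 : ∀ f ∈ E', e ≠ f → ∀ x ∈ e, x ∉ f
      · exact Or.inr (Or.inr (Or.inl (memI.2 ⟨memE'.2 ⟨he, h1⟩, h2⟩)))
      · exact Or.inr (Or.inr (Or.inr (memE''.2 ⟨memE'.2 ⟨he, h1⟩, h2⟩)))
  -- A pendant edge at `v` meets other edges only in `v`.
  have hAonly : ∀ e ∈ A, ∀ f ∈ E, e ≠ f → ∀ x, x ∈ e → x ∈ f → x = v := by
    intro e he f hf hef x hxe hxf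
    obtain ⟨w, hwe, hw⟩ := (memA.1 he).2
    by_contra hxv
    have hwv : w ≠ v := by
      rintro rfl
      omega
    have hwx : w ≠ x := by
      rintro rfl
      exact hef (eq_of_edgeDeg_eq_one hw (hAE e he) hf hxe hxf)
    have : e = s(v, w) := (Sym2.mem_and_mem_iff hwv.symm).1 ⟨hAv e he, hwe⟩
    rw [this, Sym2.mem_iff] at hxe
    rcases hxe with h' | h'
    · exact hxv h'
    · exact hwx h'.symm
  have hincA : ∀ e ∈ E, v ∉ e → ∀ f ∈ A, inc t h e f = 0 := by
    intro e he hve f hf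
    refine inc_eq_zero_of_forall_notMem hth fun x hxe hxf => ?_
    have hfe : f ≠ e := fun h' => hve (h' ▸ hAv f hf)
    have := hAonly f hf e he hfe x hxf hxe
    exact hve (this ▸ hxe)
  have hincI : ∀ e ∈ I, ∀ f ∈ E, inc t h e f ≠ 0 → f ∈ F := by
    intro e he f hf hne
    rcases hcases f hf with h1 | h1 | h1 | h1
    · exact absurd (hincA e (hIE e he) (hIv e he) f h1) hne
    · exact h1
    all_goals
      exfalso
      obtain ⟨hef, x, hxe, hxf⟩ := (inc_ne_zero_iff hth (hd e (hIE e he))).1 hne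
    · exact (memI.1 he).2 f (memI.1 h1).1 hef x hxe hxf
    · exact (memI.1 he).2 f (memE''.1 h1).1 hef x hxe hxf
  -- The weights.
  set K := F.filter fun f => ∃ e ∈ I, ∃ x, x ∈ e ∧ x ∈ f with hK
  -- Weight 2 makes `A` dominate the rows at `v`. Away from `v`, `F` must not enter the top part of
  -- the rows of `E''`: edges in `F \ K` are too light, and those in `K` do not meet `E''`.
  set w : Sym2 V → ℕ := fun e => if e ∈ A then 2 else if e ∈ F ∧ e ∉ K then 0 else 1 with hw
  have hw2 : ∀ e, w e = 2 ↔ e ∈ A := by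
    intro e
    simp only [hw]
    split_ifs with h1 h2 <;> simp [h1]
  have hwle : ∀ e, w e ≤ 2 := by
    intro e
    simp only [hw]
    split_ifs <;> norm_num
  have hwle1 : ∀ e, e ∉ A → w e ≤ 1 := by
    intro e he
    simp only [hw, if_neg he]
    split_ifs <;> norm_num
  have hw1 : ∀ e ∈ E', w e = 1 := by
    intro e he
    have hve := (memE'.1 he).2
    have h1 : e ∉ A := fun h' => hve (hAv e h')
    have h2 : e ∉ F := fun h' => hve (hFv e h')
    simp [hw, h1, h2]
  have htopF : ∀ e ∈ F, topForm w (linForm (inc t h e) E) =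
      linForm (fun _ => endSign t h v e) A := by
    intro e he
    have hval : ∀ f ∈ A, inc t h e f = endSign t h v e := fun f hf =>
      inc_eq_endSign hth (hd e (hFE e he))
        (by rintro rfl; exact Finset.disjoint_left.1 hAF hf he) (hFv e he) (hAv f hf)
    obtain ⟨a, ha⟩ := hAne
    rw [topForm_linForm (d := 2) (fun i _ _ => hwle i)
      ⟨a, hAE a ha, hval a ha ▸ endSign_ne_zero hth (hd e (hFE e he)) (hFv e he), (hw2 a).2 ha⟩]
    refine linForm_congr (fun f hf => Finset.mem_filter.2 ⟨hAE f hf, (hw2 f).2 hf⟩) hval ?_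
    intro f hf hfA
    exact absurd ((hw2 f).1 (Finset.mem_filter.1 hf).2) hfA
  have htopA : 2 ≤ A.card → ∀ e ∈ A, topForm w (linForm (inc t h e) E) =
      linForm (fun _ => endSign t h v e) (A.erase e) := by
    intro hA2 e he
    have hval : ∀ f ∈ A.erase e, inc t h e f = endSign t h v e := fun f hf =>
      inc_eq_endSign hth (hd e (hAE e he)) (Finset.ne_of_mem_erase hf).symm (hAv e he)
        (hAv f (Finset.mem_of_mem_erase hf))
    obtain ⟨a, ha⟩ : (A.erase e).Nonempty := by
      rw [← Finset.card_pos, Finset.card_erase_of_mem he]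
      omega
    have haA := Finset.mem_of_mem_erase ha
    rw [topForm_linForm (d := 2) (fun i _ _ => hwle i)
      ⟨a, hAE a haA, hval a ha ▸ endSign_ne_zero hth (hd e (hAE e he)) (hAv e he), (hw2 a).2 haA⟩]
    refine linForm_congr (fun f hf => Finset.mem_filter.2 ⟨hAE f (Finset.mem_of_mem_erase hf),
      (hw2 f).2 (Finset.mem_of_mem_erase hf)⟩) hval ?_
    intro f hf hfA
    have hfA' := (hw2 f).1 (Finset.mem_filter.1 hf).2
    have hfe : f = e := by
      by_contra hne
      exact hfA (Finset.mem_erase.2 ⟨hne, hfA'⟩)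
    rw [hfe, inc_self hth]
  have hisoE'' : NoIsolatedEdge E'' := by
    intro e he
    have h2 := (memE''.1 he).2
    push Not at h2
    obtain ⟨f, hf, hef, x, hxe, hxf⟩ := h2
    refine ⟨f, memE''.2 ⟨hf, fun h' => ?_⟩, hef, x, hxe, hxf⟩
    exact h' e (memE''.1 he).1 hef.symm x hxf hxe
  have htopE'' : ∀ e ∈ E'', topForm w (linForm (inc t h e) E) = linForm (inc t h e) E'' := by
    intro e he
    obtain ⟨f, hf, hef⟩ := hisoE'' e he
    rw [topForm_linForm (d := 1)
      (fun i _ hi => hwle1 i fun hiA => hi (hincA e (hE''E e he) (hE''v e he) i hiA))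
      ⟨f, hE''E f hf, (inc_ne_zero_iff hth (hd e (hE''E e he))).2 hef,
        hw1 f (memE''.1 hf).1⟩]
    refine linForm_congr
      (fun f hf => Finset.mem_filter.2 ⟨hE''E f hf, hw1 f (memE''.1 hf).1⟩) (fun _ _ => rfl) ?_
    intro g hg hgE''
    rw [Finset.mem_filter] at hg
    by_contra hne
    obtain ⟨heg, x, hxe, hxg⟩ := (inc_ne_zero_iff hth (hd e (hE''E e he))).1 hne
    rcases hcases g hg.1 with h1 | h1 | h1 | h1
    · exact hne (hincA e (hE''E e he) (hE''v e he) g h1)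
    -- An edge of `K` meets an edge of `I` at its end other than `v`. Meeting `e` there too would
    -- make `e` touch an edge isolated in `E'`.
    · by_cases hgK : g ∈ K
      · obtain ⟨-, e', he', y, hye', hyg⟩ := Finset.mem_filter.1 hgK
        have hxv : v ≠ x := fun h' => hE''v e he (h' ▸ hxe)
        have hyv : v ≠ y := fun h' => hIv e' he' (h' ▸ hye')
        have hgx : g = s(v, x) := (Sym2.mem_and_mem_iff hxv).1 ⟨hFv g h1, hxg⟩
        have hyx : y = x := by
          rw [hgx, Sym2.mem_iff] at hyg
          exact hyg.resolve_left hyv.symm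
        subst hyx
        refine (memI.1 he').2 e (memE''.1 he).1 ?_ y hye' hxe
        rintro rfl
        exact (memE''.1 he).2 (memI.1 he').2
      · have hgA : g ∉ A := fun h' => Finset.disjoint_left.1 hAF h' h1
        have hwg := hg.2
        simp [hw, hgA, h1, hgK] at hwg
    · exact (memI.1 h1).2 e (memE''.1 he).1 heg.symm x hxg hxe
    · exact hgE'' h1
  -- The isolated edges give forms in the variables of `F`.
  have hdegI0 : ∀ f, f ∉ F → degreeOf f (∏ e ∈ I, linForm (inc t h e) E) = 0 := by
    intro f hf
    have := degreeOf_prod_linForm_le I (inc t h) (fun _ => E) f (u := ∅)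
      (fun e he hfE hne => absurd (hincI e he f hfE hne) hf)
    simpa using this
  have hdegI1 : ∀ f ∈ F, degreeOf f (∏ e ∈ I, linForm (inc t h e) E) ≤ 1 := by
    intro f hf
    refine (degreeOf_prod_linForm_le I (inc t h) (fun _ => E) f
      (u := I.filter fun e => inc t h e f ≠ 0)
      (fun e he _ hne => Finset.mem_filter.2 ⟨he, hne⟩)).trans ?_
    refine Finset.card_le_one.2 fun e he e' he' => ?_
    rw [Finset.mem_filter] at he he'
    -- Both isolated edges meet `f` at its end other than `v`, so they meet each other and coincide.
    obtain ⟨-, x, hxe, hxf⟩ := (inc_ne_zero_iff hth (hd e (hIE e he.1))).1 he.2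
    obtain ⟨-, y, hye', hyf⟩ := (inc_ne_zero_iff hth (hd e' (hIE e' he'.1))).1 he'.2
    have hxv : v ≠ x := fun h' => hIv e he.1 (h' ▸ hxe)
    have hyv : v ≠ y := fun h' => hIv e' he'.1 (h' ▸ hye')
    have hgx : f = s(v, x) := (Sym2.mem_and_mem_iff hxv).1 ⟨hFv f hf, hxf⟩
    have hyx : y = x := by
      rw [hgx, Sym2.mem_iff] at hyf
      exact hyf.resolve_left hyv.symm
    subst hyx
    by_contra hne
    exact (memI.1 he.1).2 e' (memI.1 he'.1).1 hne y hxe hye'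
  have hIne : ∏ e ∈ I, linForm (inc t h e) E ≠ 0 :=
    Finset.prod_ne_zero_iff.2 fun e he => linForm_inc_ne_zero hth hd hiso (hIE e he)
  have hεne : ∀ e ∈ D, endSign t h v e ≠ 0 := fun e he =>
    endSign_ne_zero hth (hd e (memD.1 he).1) (memD.1 he).2
  -- `q₁` collects the factors in the variables of `A`, `q₂` those in the variables of `F`; the rows
  -- of `A` go to one or the other according to whether `A` has at least two elements.
  have key : ∃ q₁ q₂ : MvPolynomial (Sym2 V) ℝ,
      topForm w ((∏ e ∈ A, linForm (inc t h e) E) * (∏ e ∈ F, linForm (inc t h e) E) *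
        ∏ e ∈ I, linForm (inc t h e) E) = q₁ * q₂ ∧
      HasSmallMonomial q₁ ∧ HasSmallMonomial q₂ ∧
      (∀ i, i ∉ A → degreeOf i q₁ = 0) ∧ (∀ i, i ∉ F → degreeOf i q₂ = 0) := by
    have htF : topForm w (∏ e ∈ F, linForm (inc t h e) E) =
        ∏ e ∈ F, linForm (fun _ => endSign t h v e) A := by
      rw [topForm_prod]
      exact Finset.prod_congr rfl htopF
    have hdegF : ∀ i, i ∉ A → degreeOf i (∏ e ∈ F, linForm (fun _ => endSign t h v e) A) = 0 := by
      intro i hi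
      have := degreeOf_prod_linForm_le F (fun e _ => endSign t h v e) (fun _ => A) i (u := ∅)
        (fun e _ hiA => absurd hiA hi)
      simpa using this
    by_cases hA2 : 2 ≤ A.card
    · refine ⟨_, topForm w (∏ e ∈ I, linForm (inc t h e) E), ?_, hasSmallMonomial_star hAF hA2 hF2
        (ε := endSign t h v) ?_, ?_, ?_, ?_⟩
      · rw [topForm_mul, topForm_mul, htF, topForm_prod w A, Finset.prod_congr rfl (htopA hA2)]
      · intro e he
        rcases Finset.mem_union.1 he with h' | h'
        · exact hεne e (memA.1 h').1
        · exact hεne e (memF.1 h').1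
      · refine hasSmallMonomial_of_degreeOf_le (topForm_ne_zero w hIne) fun f => ?_
        refine (degreeOf_topForm_le w _ f).trans ?_
        by_cases hf : f ∈ F
        · exact (hdegI1 f hf).trans one_le_two
        · simp [hdegI0 f hf]
      · intro i hi
        have h1 := degreeOf_prod_linForm_le A (fun e _ => endSign t h v e) (fun e => A.erase e) i
          (u := ∅) (fun e _ hiA => absurd (Finset.mem_of_mem_erase hiA) hi)
        have h2 := hdegF i hi
        refine Nat.le_zero.1 ((degreeOf_mul_le _ _ _).trans ?_)
        rw [h2]
        simpa using h1
      · intro i hi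
        exact Nat.le_zero.1 ((degreeOf_topForm_le w _ i).trans (hdegI0 i hi).le)
    · have hA1 : A.card = 1 := by
        have := hAne.card_pos
        omega
      obtain ⟨a, haA⟩ := Finset.card_eq_one.1 hA1
      have ha : a ∈ A := by simp [haA]
      have hinca : ∀ f ∈ E, inc t h a f ≠ 0 → f ∈ F := by
        intro f hf hne
        obtain ⟨haf, x, hxa, hxf⟩ := (inc_ne_zero_iff hth (hd a (hAE a ha))).1 hne
        have hxv := hAonly a ha f hf haf x hxa hxf
        subst hxv
        refine memF.2 ⟨memD.2 ⟨hf, hxf⟩, fun hw' => haf ?_⟩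
        have : f ∈ A := memA.2 ⟨memD.2 ⟨hf, hxf⟩, hw'⟩
        rw [haA, Finset.mem_singleton] at this
        exact this.symm
      have hdeg0 : ∀ f, f ∉ F → degreeOf f
          (linForm (inc t h a) E * ∏ e ∈ I, linForm (inc t h e) E) = 0 := by
        intro f hf
        refine Nat.le_zero.1 ((degreeOf_mul_le _ _ _).trans ?_)
        rw [hdegI0 f hf, degreeOf_linForm_eq_zero]
        intro hfE
        by_contra hne
        exact hf (hinca f hfE hne)
      -- With a single pendant edge `a`, the rows of `F` give a multiple of `X a ^ F.card`, and
      -- `F.card ≤ 2`. The row of `a` adds at most one to each degree in `F`, on top of at most one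
      -- from `I`.
      refine ⟨∏ e ∈ F, linForm (fun _ => endSign t h v e) A,
        topForm w (linForm (inc t h a) E * ∏ e ∈ I, linForm (inc t h e) E), ?_, ?_, ?_, hdegF, ?_⟩
      · rw [haA, Finset.prod_singleton, ← haA, topForm_mul, topForm_mul, topForm_mul, htF]
        ring
      · refine hasSmallMonomial_prod_sum_X F _ (fun e he => hεne e (memF.1 he).1) _ (fun _ => a)
          (fun _ _ => ha) fun j => ?_
        rw [Finset.sum_const, Finsupp.smul_apply, Finsupp.single_apply]
        split_ifs
        · simpa using hF2
        · simp
      · refine hasSmallMonomial_of_degreeOf_le (topForm_ne_zero w (mul_ne_zero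
          (linForm_inc_ne_zero hth hd hiso (hAE a ha)) hIne)) fun f => ?_
        refine (degreeOf_topForm_le w _ f).trans ?_
        by_cases hf : f ∈ F
        · have h1 := degreeOf_linForm_le (inc t h a) E f
          have h2 := hdegI1 f hf
          exact (degreeOf_mul_le _ _ _).trans (by omega)
        · simp [hdeg0 f hf]
      · intro i hi
        exact Nat.le_zero.1 ((degreeOf_topForm_le w _ i).trans (hdeg0 i hi).le)
  obtain ⟨q₁, q₂, hq, hs₁, hs₂, hd₁, hd₂⟩ := key
  have hsmall : HasSmallMonomial (edgePoly t h E'') := by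
    refine ih E'' (Finset.ssubset_iff_subset_ne.2 ⟨hE''E, ?_⟩)
      (fun e he => hd e (hE''E e he)) hisoE''
      (fun S E₀ hE₀ hS => hsp S E₀ (fun e he => hE''E e (hE₀ he)) hS)
    intro heq
    obtain ⟨a, ha⟩ := hAne
    have : a ∈ E'' := by
      rw [heq]
      exact hAE a ha
    exact hE''v a this (hAv a ha)
  have hdE'' : ∀ i, i ∉ E'' → degreeOf i (edgePoly t h E'') = 0 := by
    intro i hi
    have := degreeOf_prod_linForm_le E'' (inc t h) (fun _ => E'') i (u := ∅)
      (fun e _ hiE => absurd hiE hi)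
    simpa [edgePoly] using this
  have hsplit : edgePoly t h E = (∏ e ∈ A, linForm (inc t h e) E) *
      (∏ e ∈ F, linForm (inc t h e) E) * (∏ e ∈ I, linForm (inc t h e) E) *
      ∏ e ∈ E'', linForm (inc t h e) E := by
    rw [Finset.prod_filter_mul_prod_filter_not, mul_assoc, Finset.prod_filter_mul_prod_filter_not,
      Finset.prod_filter_mul_prod_filter_not]
    rfl
  refine HasSmallMonomial.of_topForm (w := w) ?_
  rw [hsplit, topForm_mul, hq, topForm_prod w E'', Finset.prod_congr rfl htopE'', ← edgePoly]
  refine (hs₁.mul hs₂ fun i => ?_).mul hsmall fun i => ?_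
  · by_cases hi : i ∈ A
    · exact Or.inr (hd₂ i fun hiF => Finset.disjoint_left.1 hAF hi hiF)
    · exact Or.inl (hd₁ i hi)
  · by_cases hi : i ∈ E''
    · refine Or.inl (Nat.le_zero.1 ((degreeOf_mul_le _ _ _).trans ?_))
      rw [hd₁ i fun h' => hE''v i hi (hAv i h'), hd₂ i fun h' => hE''v i hi (hFv i h')]
    · exact Or.inr (hdE'' i hi)

end EdgeSets

/-! ### From small monomials to permanents and list choices -/

section Permanent

variable {R C : Type*} [Fintype R] [DecidableEq R] [Fintype C] [DecidableEq C]

theorem coeff_prod_linForm_univ (M : Matrix R C ℝ) (m : C →₀ ℕ) :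
    coeff m (∏ i, linForm (M i) Finset.univ) =
      ∑ c : R → C with ∑ i, Finsupp.single (c i) 1 = m, ∏ i, M i (c i) := by
  simp only [linForm, Finset.prod_univ_sum, coeff_sum, Fintype.piFinset_univ,
    Finset.sum_filter]
  refine Finset.sum_congr rfl fun c _ => ?_
  have : ∏ i, (MvPolynomial.C (M i (c i)) * X (c i) : MvPolynomial C ℝ) =
      monomial (∑ i, Finsupp.single (c i) 1) (∏ i, M i (c i)) := by
    rw [monomial_sum_index, map_prod, ← Finset.prod_mul_distrib]
    rfl
  rw [this, coeff_monomial]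

omit [DecidableEq R] [Fintype C] in
theorem exists_perm_of_sum_single_eq {c c' : R → C}
    (h : ∑ i, Finsupp.single (c i) 1 = (∑ i, Finsupp.single (c' i) 1 : C →₀ ℕ)) :
    ∃ τ : Equiv.Perm R, c' ∘ τ = c := by
  have hcard : ∀ j, Fintype.card {i // c i = j} = Fintype.card {i // c' i = j} := by
    intro j
    have := DFunLike.congr_fun h j
    simp only [Finsupp.finsetSum_apply, Finsupp.single_apply, ← Finset.card_filter] at this
    rw [Fintype.card_subtype, Fintype.card_subtype, this]
  exact ⟨Equiv.ofFiberEquiv fun j => Fintype.equivOfCardEq (hcard j),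
    funext fun i => Equiv.ofFiberEquiv_map _ i⟩

/-- The permanent of a matrix of columns of `M` is a positive multiple of a coefficient of the
product of the row forms of `M`. -/
theorem permanent_submatrix_eq (M : Matrix R C ℝ) (c : R → C) :
    (M.submatrix id c).permanent =
      (Finset.univ.filter fun σ : Equiv.Perm R => c ∘ ⇑σ⁻¹ = c).card *
        coeff (∑ i, Finsupp.single (c i) 1) (∏ i, linForm (M i) Finset.univ) := by
  rw [coeff_prod_linForm_univ, Matrix.permanent, Finset.mul_sum]
  have h1 : ∀ σ : Equiv.Perm R, ∏ i, M.submatrix id c (σ i) i = ∏ i, M i ((c ∘ ⇑σ⁻¹) i) := by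
    intro σ
    rw [← Equiv.prod_comp σ fun i => M i ((c ∘ ⇑σ⁻¹) i)]
    simp
  -- Permutations are grouped by the rearrangement `c'` of `c` they induce. Each group is a coset of
  -- the stabiliser of `c`, so all have the same size.
  rw [Finset.sum_congr rfl fun σ _ => h1 σ, ← Finset.sum_fiberwise_of_maps_to
    (g := fun σ : Equiv.Perm R => c ∘ ⇑σ⁻¹)
    (t := Finset.univ.filter fun c' : R → C =>
      ∑ i, Finsupp.single (c' i) 1 = (∑ i, Finsupp.single (c i) 1 : C →₀ ℕ))]
  · refine Finset.sum_congr rfl fun c' hc' => ?_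
    obtain ⟨τ, hτ⟩ := exists_perm_of_sum_single_eq (Finset.mem_filter.1 hc').2.symm
    have h2 : ∀ σ ∈ Finset.univ.filter (fun σ : Equiv.Perm R => c ∘ ⇑σ⁻¹ = c'),
        ∏ i, M i ((c ∘ ⇑σ⁻¹) i) = ∏ i, M i (c' i) := by
      intro σ hσ
      rw [(Finset.mem_filter.1 hσ).2]
    rw [Finset.sum_congr rfl h2, Finset.sum_const, nsmul_eq_mul]
    congr 2
    refine Finset.card_equiv (Equiv.mulLeft τ⁻¹) fun σ => ?_
    simp only [Finset.mem_filter, Finset.mem_univ, true_and, Equiv.coe_mulLeft, mul_inv_rev,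
      inv_inv, Equiv.Perm.coe_mul]
    constructor
    · intro h
      rw [← Function.comp_assoc, h, hτ]
    · intro h
      rw [← Function.comp_assoc, ← hτ] at h
      have := congrArg (fun f => f ∘ ⇑τ⁻¹) h
      simp only [Function.comp_assoc, ← Equiv.Perm.coe_mul, mul_inv_cancel, Equiv.Perm.coe_one,
        Function.comp_id] at this
      rw [← hτ, Function.comp_assoc, ← Equiv.Perm.coe_mul]
      rwa [mul_assoc, mul_inv_cancel, mul_one] at this
  · intro σ _
    refine Finset.mem_filter.2 ⟨Finset.mem_univ _, ?_⟩
    exact Equiv.sum_comp σ⁻¹ fun i => (Finsupp.single (c i) 1 : C →₀ ℕ)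

theorem hasPermWitness_of_hasSmallMonomial {M : Matrix R C ℝ}
    (h : HasSmallMonomial (∏ i, linForm (M i) Finset.univ)) : HasPermWitness M 2 := by
  obtain ⟨m, hm, hc⟩ := h
  have hc' := hc
  rw [coeff_prod_linForm_univ] at hc'
  obtain ⟨c, hcm, -⟩ := Finset.exists_ne_zero_of_sum_ne_zero hc'
  obtain rfl := (Finset.mem_filter.1 hcm).2
  refine ⟨c, ?_, fun j => ?_⟩
  · rw [permanent_submatrix_eq]
    refine mul_ne_zero (Nat.cast_ne_zero.2 (Finset.card_ne_zero.2 ⟨1, ?_⟩)) hc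
    exact Finset.mem_filter.2 ⟨Finset.mem_univ _, by rw [inv_one]; rfl⟩
  · have := hm j
    simpa only [Finsupp.finsetSum_apply, Finsupp.single_apply, ← Finset.card_filter] using this

theorem pind_le_two_of_hasSmallMonomial {M : Matrix R C ℝ}
    (h : HasSmallMonomial (∏ i, linForm (M i) Finset.univ)) : pind M ≤ 2 :=
  iInf₂_le 2 (hasPermWitness_of_hasSmallMonomial h)

omit [DecidableEq R] [DecidableEq C] in
/-- A system of affine forms whose linear parts have a small monomial in their product can be made
nowhere zero by choosing the variables from lists of size three. -/
theorem exists_forall_affine_ne_zero {M : Matrix R C ℝ}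
    (h : HasSmallMonomial (∏ i, linForm (M i) Finset.univ)) (a : R → ℝ) (S : C → Finset ℝ)
    (hS : ∀ j, (S j).card = 3) :
    ∃ x : C → ℝ, (∀ j, x j ∈ S j) ∧ ∀ i, ∑ j, M i j * x j + a i ≠ 0 := by
  classical
  obtain ⟨m, hm, hc⟩ := h
  set p : MvPolynomial C ℝ := ∏ i, (linForm (M i) Finset.univ + MvPolynomial.C (a i)) with hp
  have hne : ∀ i, linForm (M i) Finset.univ ≠ 0 := by
    intro i hi
    rw [Finset.prod_eq_zero (Finset.mem_univ i) hi] at hc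
    exact hc (coeff_zero m)
  -- With all weights 1 the top part discards the constants `a i`, so the coefficient at `m`
  -- survives in the affine product.
  have htop : topForm (fun _ => 1) p = ∏ i, linForm (M i) Finset.univ := by
    rw [hp, topForm_prod]
    refine Finset.prod_congr rfl fun i _ => ?_
    have : weightHom (fun _ => 1) (linForm (M i) Finset.univ + MvPolynomial.C (a i)) =
        Polynomial.C (linForm (M i) Finset.univ) * Polynomial.X +
          Polynomial.C (MvPolynomial.C (a i)) := by
      simp only [linForm, map_add, map_sum, weightHom_C_mul_X, pow_one, Finset.sum_mul]
      congr 1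
      simp [weightHom]
    rw [topForm, this, Polynomial.leadingCoeff_linear (hne i)]
  have hcp : coeff m p ≠ 0 :=
    coeff_ne_zero_of_coeff_topForm_ne_zero (w := fun _ => 1) (by rwa [htop])
  have hlin : ∀ i, (linForm (M i) Finset.univ).IsHomogeneous 1 := fun i =>
    IsHomogeneous.sum _ _ _ fun j _ => isHomogeneous_C_mul_X _ _
  have hdegm : Finsupp.degree m = Fintype.card R := by
    have := (IsHomogeneous.prod Finset.univ _ _ fun i _ => hlin i) hc
    rw [Finsupp.degree_eq_weight_one]
    exact this.trans (by simp)
  have hdegp : p.totalDegree = Finsupp.degree m := by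
    refine le_antisymm ?_ (le_totalDegree (mem_support_iff.2 hcp))
    rw [hdegm, hp]
    refine (totalDegree_finsetProd _ _).trans ?_
    refine (Finset.sum_le_card_nsmul Finset.univ _ 1 fun i _ => ?_).trans (by simp)
    exact (totalDegree_add _ _).trans (max_le (hlin i).totalDegree_le (by simp))
  obtain ⟨x, hxS, hx⟩ := combinatorial_nullstellensatz_exists_eval_nonzero p m hcp hdegp S
    fun j => by
      have := hm j
      rw [hS j]
      omega
  refine ⟨x, hxS, fun i => ?_⟩
  rw [hp, map_prod] at hx
  have := Finset.prod_ne_zero_iff.1 hx i (Finset.mem_univ i)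
  simpa [linForm] using this

end Permanent

/-! ### Transfer to the matrix of a graph -/

section Graph

variable {V : Type*} [DecidableEq V] {G : SimpleGraph V} [Fintype G.edgeSet]

omit [Fintype G.edgeSet] in
-- The exclusion `y ≠ e` in `matrixA` is automatic here: on the diagonal both indicators are 1 and
-- cancel.
theorem matrixB_apply (D : EdgeOrientation G) (e f : G.edgeSet) :
    matrixB D e f = (if D.head e ∈ (f : Sym2 V) then 1 else 0) -
      (if D.tail e ∈ (f : Sym2 V) then 1 else 0) := by
  have hmk := D.mk_eq e
  have hne : D.tail e ≠ D.head e := by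
    have := e.2
    rw [← hmk, SimpleGraph.mem_edgeSet] at this
    exact this.ne
  have hh : D.head e ∈ (e : Sym2 V) := hmk ▸ Sym2.mem_mk_right _ _
  have ht : D.tail e ∈ (e : Sym2 V) := hmk ▸ Sym2.mem_mk_left _ _
  by_cases hfe : f = e
  · subst hfe
    simp [matrixB, matrixA, hh, ht]
  · have hnot : ¬ (D.head e ∈ (f : Sym2 V) ∧ D.tail e ∈ (f : Sym2 V)) := fun h' =>
      hfe (Subtype.ext (eq_of_mem_of_mem hne.symm h'.1 h'.2 hh ht))
    by_cases h1 : D.head e ∈ (f : Sym2 V) <;> by_cases h2 : D.tail e ∈ (f : Sym2 V)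
    · exact absurd ⟨h1, h2⟩ hnot
    all_goals simp [matrixB, matrixA, hfe, h1, h2]

/-- The rows of the edge-edge matrix of a sparse graph without isolated edges. -/
theorem hasSmallMonomial_matrixB [Fintype V] (D : EdgeOrientation G)
    (hiso : NoIsolatedEdge G.edgeFinset) (hsp : IsSparse G.edgeFinset) :
    HasSmallMonomial (∏ e, linForm (matrixB D e) Finset.univ) := by
  classical
  -- Non-edges get an arbitrary representative, so that `hth` holds on all of `Sym2 V`.
  let t : Sym2 V → V := fun e => if he : e ∈ G.edgeSet then D.tail ⟨e, he⟩ else e.out.1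
  let h : Sym2 V → V := fun e => if he : e ∈ G.edgeSet then D.head ⟨e, he⟩ else e.out.2
  have hth : ∀ e, s(t e, h e) = e := by
    intro e
    by_cases he : e ∈ G.edgeSet
    · simp only [t, h, dif_pos he]
      exact D.mk_eq ⟨e, he⟩
    · simp only [t, h, dif_neg he]
      exact Quot.out_eq e
  have hinc : ∀ e f : G.edgeSet, inc t h e f = matrixB D e f := by
    intro e f
    rw [matrixB_apply]
    simp only [inc, t, h, dif_pos e.2]
  obtain ⟨m, hm, hc⟩ := hasSmallMonomial_edgePoly hth G.edgeFinset
    (fun e he => G.not_isDiag_of_mem_edgeSet (SimpleGraph.mem_edgeFinset.1 he)) hiso hsp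
  have hsum : ∀ e : G.edgeSet, linForm (inc t h e) G.edgeFinset =
      rename Subtype.val (linForm (matrixB D e) Finset.univ) := by
    intro e
    simp only [linForm, map_sum, map_mul, rename_C, rename_X, ← hinc]
    rw [SimpleGraph.edgeFinset]
    exact (Finset.sum_set_coe G.edgeSet
      (f := fun f => MvPolynomial.C (inc t h e f) * X f)).symm
  have hren : edgePoly t h G.edgeFinset =
      rename Subtype.val (∏ e, linForm (matrixB D e) Finset.univ) := by
    rw [map_prod, edgePoly, ← Finset.prod_congr rfl fun e _ => hsum e]
    exact (Finset.prod_set_coe G.edgeSet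
      (f := fun e => linForm (inc t h e) G.edgeFinset)).symm
  rw [hren] at hc
  obtain ⟨u, rfl, hu⟩ := coeff_rename_ne_zero _ _ _ hc
  refine ⟨u, fun e => ?_, hu⟩
  have := hm e
  rwa [Finsupp.mapDomain_apply Subtype.val_injective] at this

/-- Once vertex weights are fixed, the difference of the weights at the ends of an edge is an affine
form in the edge weights, with linear part a row of `matrixB D`. -/
theorem isChoosable_of_hasSmallMonomial (D : EdgeOrientation G)
    (h : HasSmallMonomial (∏ e, linForm (matrixB D e) Finset.univ)) : IsChoosable G 1 3 := by
  intro L hL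
  have hLV : ∀ v, ∃ x, x ∈ L (.inl v) := fun v => by
    refine Finset.card_pos.1 ?_
    rw [hL]
    exact one_pos
  choose y hy using hLV
  obtain ⟨x, hxL, hx⟩ := exists_forall_affine_ne_zero h (fun e => y (D.head e) - y (D.tail e))
    (fun e => L (.inr e)) (fun e => hL _)
  refine ⟨Sum.elim y x, fun u v huv => ?_, ?_⟩
  · have key : ∀ e : G.edgeSet, vertexWeight G (Sum.elim y x) (D.head e) ≠
        vertexWeight G (Sum.elim y x) (D.tail e) := by
      intro e heq
      apply hx e
      simp only [vertexWeight, Sum.elim_inl, Sum.elim_inr, Finset.sum_filter] at heq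
      have : ∑ f, matrixB D e f * x f = (∑ f : G.edgeSet, if D.head e ∈ (f : Sym2 V) then x f else 0) -
          ∑ f : G.edgeSet, if D.tail e ∈ (f : Sym2 V) then x f else 0 := by
        rw [← Finset.sum_sub_distrib]
        refine Finset.sum_congr rfl fun f _ => ?_
        rw [matrixB_apply, sub_mul, ite_mul, ite_mul, one_mul, zero_mul]
      rw [this]
      linarith
    have he := D.mk_eq ⟨s(u, v), huv⟩
    have hk := key ⟨s(u, v), huv⟩
    rcases Sym2.eq_iff.1 he with ⟨h1, h2⟩ | ⟨h1, h2⟩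
    · rw [h1, h2] at hk
      exact hk.symm
    · rw [h1, h2] at hk
      exact hk
  · rintro (v | e)
    · exact hy v
    · exact hxL e

omit [DecidableEq V] [Fintype G.edgeSet] in
theorem nonempty_edgeOrientation : Nonempty (EdgeOrientation G) :=
  ⟨⟨fun e => (e : Sym2 V).out.1, fun e => (e : Sym2 V).out.2, fun e => Quot.out_eq (e : Sym2 V)⟩⟩

end Graph

/-! ### Counting edges in connected and unicyclic graphs -/

section Unicyclic

variable {V : Type*} {G : SimpleGraph V}

theorem exists_adj_dist_lt (hG : G.Connected) {s v : V} (hv : v ≠ s) :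
    ∃ u, G.Adj v u ∧ G.dist u s < G.dist v s := by
  obtain ⟨p, hp⟩ := (hG.preconnected v s).exists_walk_length_eq_dist
  cases p with
  | nil => exact absurd rfl hv
  | cons hadj q =>
    refine ⟨_, hadj, ?_⟩
    have := SimpleGraph.dist_le q
    rw [SimpleGraph.Walk.length_cons] at hp
    omega

/-- Fix `s` in `S` and send each vertex outside `S` to its first edge on a shortest path to `s`.
These edges are not in `E'`, and they are distinct because distance to `s` strictly drops along
each; so `n - S.card ≤ m - E'.card`. -/
theorem isSparse_edgeFinset [Fintype V] [DecidableEq V] [Fintype G.edgeSet] (hG : G.Connected)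
    (hm : G.edgeFinset.card ≤ Fintype.card V) : IsSparse G.edgeFinset := by
  intro S E' hE' hS
  rcases S.eq_empty_or_nonempty with rfl | ⟨s, hs⟩
  · have : E' = ∅ := by
      refine Finset.eq_empty_of_forall_notMem fun e he => ?_
      induction e using Sym2.ind with
      | _ x y => exact absurd (hS _ he x (Sym2.mem_mk_left x y)) (Finset.notMem_empty x)
    simp [this]
  · have hpar : ∀ v, ∃ u, v ≠ s → G.Adj v u ∧ G.dist u s < G.dist v s := by
      intro v
      by_cases hv : v = s
      · exact ⟨v, fun h => absurd hv h⟩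
      · obtain ⟨u, hu⟩ := exists_adj_dist_lt hG hv
        exact ⟨u, fun _ => hu⟩
    choose par hpar using hpar
    have hne : ∀ v ∈ Sᶜ, v ≠ s := by
      rintro v hv rfl
      exact Finset.mem_compl.1 hv hs
    have hcard : (Sᶜ).card ≤ (G.edgeFinset \ E').card := by
      refine Finset.card_le_card_of_injOn (fun v => s(v, par v)) ?_ ?_
      · intro v hv
        have hv' : v ∈ Sᶜ := hv
        refine Finset.mem_coe.2 (Finset.mem_sdiff.2
          ⟨SimpleGraph.mem_edgeFinset.2 (hpar v (hne v hv')).1, fun h => ?_⟩)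
        exact Finset.mem_compl.1 hv' (hS _ h v (Sym2.mem_mk_left _ _))
      · intro v hv w hw hvw
        rcases Sym2.eq_iff.1 hvw with ⟨h, -⟩ | ⟨h1, h2⟩
        · exact h
        · have h3 := (hpar v (hne v hv)).2
          have h4 := (hpar w (hne w hw)).2
          rw [h2] at h3
          rw [← h1] at h4
          omega
    rw [Finset.card_sdiff_of_subset hE', Finset.card_compl] at hcard
    have h1 := Finset.card_le_card hE'
    have h2 := Finset.card_le_univ S
    omega

/-- By connectedness an isolated edge would be the whole graph, leaving `n ≤ 2`; but then `n.choose
2 < n`. -/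
theorem noIsolatedEdge_edgeFinset [Fintype V] [Fintype G.edgeSet] (hG : G.Connected)
    (hm : G.edgeFinset.card = Fintype.card V) : NoIsolatedEdge G.edgeFinset := by
  classical
  intro e he
  by_contra! hcon
  have hclosed : ∀ x y, G.Walk x y → x ∈ e → y ∈ e := by
    intro x y p
    induction p with
    | nil => exact id
    | @cons a b _ hab _ ih =>
      intro ha
      refine ih ?_
      by_cases hf : e = s(a, b)
      · rw [hf]
        exact Sym2.mem_mk_right _ _
      · exact absurd (Sym2.mem_mk_left a b)
          (hcon s(a, b) (SimpleGraph.mem_edgeFinset.2 hab) hf a ha)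
  induction e using Sym2.ind with
  | _ a b =>
    have huniv : (Finset.univ : Finset V) ⊆ {a, b} := by
      intro x _
      obtain ⟨p⟩ := hG.preconnected a x
      simpa using hclosed a x p (Sym2.mem_mk_left a b)
    have hle : Fintype.card V ≤ 2 := (Finset.card_le_card huniv).trans Finset.card_le_two
    have hpos : 0 < Fintype.card V := Fintype.card_pos_iff.2 ⟨a⟩
    have hch := G.card_edgeFinset_le_card_choose_two
    rw [hm] at hch
    generalize Fintype.card V = n at *
    interval_cases n <;> simp at hch

theorem IsUnicyclic.card_edgeFinset [Fintype V] [Fintype G.edgeSet] (hG : IsUnicyclic G) :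
    G.edgeFinset.card = Fintype.card V := by
  classical
  obtain ⟨hconn, C, ⟨u, p, hp, hpC⟩, huniq⟩ := hG
  obtain ⟨e, he⟩ := List.exists_mem_of_ne_nil p.edges (fun h =>
    hp.not_nil (SimpleGraph.Walk.edges_eq_nil.1 h))
  have heG := p.edges_subset_edgeSet he
  have hbridge : ¬ G.IsBridge e := fun h =>
    (SimpleGraph.isBridge_iff_forall_cycle_notMem heG).1 h p hp he
  have hconn' : (G.deleteEdges {e}).Connected := by
    induction e using Sym2.ind with
    | _ x y => exact hconn.connected_delete_edge_of_not_isBridge hbridge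
  have hacyc : (G.deleteEdges {e}).IsAcyclic := by
    intro x c hc
    have hle : G.deleteEdges {e} ≤ G := SimpleGraph.deleteEdges_le _
    -- Any cycle surviving the deletion would be the unique cycle of `G`, which contains the deleted
    -- edge `e`.
    have heq := huniq (c.mapLe hle).toSubgraph ⟨x, c.mapLe hle, hc.mapLe hle, rfl⟩
    have hmem : e ∈ (c.mapLe hle).edges := by
      rw [← SimpleGraph.Walk.mem_edges_toSubgraph, heq, ← hpC,
        SimpleGraph.Walk.mem_edges_toSubgraph]
      exact he
    rw [SimpleGraph.Walk.edges_mapLe_eq_edges] at hmem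
    have := c.edges_subset_edgeSet hmem
    simp at this
  have htree := (SimpleGraph.IsTree.mk hconn' hacyc).card_edgeFinset
  have hE : (G.deleteEdges {e}).edgeFinset = G.edgeFinset.erase e := by
    ext f
    simp [and_comm]
  rw [hE, Finset.card_erase_of_mem (SimpleGraph.mem_edgeFinset.2 heG)] at htree
  have := Finset.card_pos.2 ⟨e, SimpleGraph.mem_edgeFinset.2 heG⟩
  omega

end Unicyclic

end TotalWeighting

theorem theorem3p2 {V : Type*} [Fintype V] [DecidableEq V] (G : SimpleGraph V)
    [DecidableRel G.Adj] :
    (TotalWeighting.IsUnicyclic G →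
      (∀ D : TotalWeighting.EdgeOrientation G,
        TotalWeighting.pind (TotalWeighting.matrixB D) ≤ 2) ∧
      TotalWeighting.IsChoosable G 1 3) ∧
    (G.Connected → G.edgeFinset.card = Fintype.card V →
      TotalWeighting.IsChoosable G 1 3) := by
  have hsmall := fun (hG : G.Connected) (hm : G.edgeFinset.card = Fintype.card V)
      (D : TotalWeighting.EdgeOrientation G) =>
    TotalWeighting.hasSmallMonomial_matrixB D (TotalWeighting.noIsolatedEdge_edgeFinset hG hm)
      (TotalWeighting.isSparse_edgeFinset hG hm.le)
  obtain ⟨D₀⟩ := TotalWeighting.nonempty_edgeOrientation (G := G)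
  refine ⟨fun hU => ⟨fun D => ?_, ?_⟩, fun hG hm => ?_⟩
  · exact TotalWeighting.pind_le_two_of_hasSmallMonomial (hsmall hU.1 hU.card_edgeFinset D)
  · exact TotalWeighting.isChoosable_of_hasSmallMonomial D₀ (hsmall hU.1 hU.card_edgeFinset D₀)
  · exact TotalWeighting.isChoosable_of_hasSmallMonomial D₀ (hsmall hG hm D₀)
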